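/- Let $\varphi>0$, $\delta>0$ and an integer $K\ge 1$ be fixed. Let $N$ be a multiple of $K$, let $[N]=V_1\cup\dots\cup V_K$ be a partition into sets of equal size $N/K$, and write $i\sim j$ if $i,j$ lie in the same $V_\ell$. Let $p_s,p_d$ (which may depend on $N$) satisfy $N^{-1+2\varphi}\le p_s,p_d\le N^{-2\varphi}$, and put $$\sigma^2=\frac NK\,p_s(1-p_s)+\frac{N(K-1)}K\,p_d(1-p_d),\qquad \sigma>0 .$$ Let $A$ be a random real symmetric $N\times N$ matrix whose entries are independent up to the symmetry, with $A_{ii}=0$ almost surely and, for $i\ne j$, $\mathbb P(A_{ij}=1/\sigma)=p_{ij}$ and $\mathbb P(A_{ij}=0)=1-p_{ij}$, where $p_{ij}=p_s$ if $i\sim j$ and $p_{ij}=p_d$ otherwise. Let $\widetilde A=A-\mathbb E A$, and write $\lambda_1^M\ge\dots\ge\lambda_N^M$ for the eigenvalues of a real symmetric matrix $M$. If $K\ge2$, assume moreover that the communities are separated in the sense that $$\frac{N(p_s-p_d)}{K}\ \ge\ (4+\delta)\,\sigma ,$$ which holds for all large $N$ if, for instance, $p_d\le(1-\varepsilon)p_s$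 for a fixed $\varepsilon>0$. Then there are constants $c>0$ and $\gamma>0$ depending only on $\varphi,\delta,K$ such that for every $D>0$ there is $N_0=N_0(D,\varphi,\delta,K)$ such that for all $N\ge N_0$, with probability at least $1-N^{-D}$, $$\lambda_N^{A}\le\dots\le\lambda_{K+1}^{A}\le\lambda_1^{\widetilde A}\le 2+c\le\lambda_K^{A}\le\dots\le\lambda_1^{A}\qquad\text{and}\qquad \lambda_K^A-\lambda_{K+1}^A\ge\gamma .$$ In particular the $K$ largest eigenvalues of $A$ are separated from all the others by a gap of order one. -/

import Mathlib

open MeasureTheory ProbabilityTheory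

noncomputable section

namespace SparseSBM

/-- The `k`-th largest eigenvalue `λ_k` (counted with multiplicity, `k = 1, …, N`) of a real
symmetric `N × N` matrix, so that `λ_N ≤ … ≤ λ_1`. Outside this range of `k`, or for a matrix that
is not symmetric, the value is `0` by convention. -/
def eigenvalue {N : ℕ} (M : Matrix (Fin N) (Fin N) ℝ) (k : ℕ) : ℝ :=
  open Classical in
  if h : M.IsHermitian ∧ 1 ≤ k ∧ k ≤ N then
    h.1.eigenvalues₀ ⟨k - 1, by rw [Fintype.card_fin]; omega⟩
  else 0

/-- The labelling `g` splits the `N` vertices into `K` communities `g ⁻¹' {a}` of the same size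
`N / K` (in particular `K` divides `N`). -/
def IsBalanced {N K : ℕ} (g : Fin N → Fin K) : Prop :=
  ∀ a : Fin K, K * (Finset.univ.filter fun i => g i = a).card = N

/-- The scaling `σ`, where `σ² = (N/K) p_s (1 - p_s) + (N (K-1)/K) p_d (1 - p_d)`. -/
def scale (N K : ℕ) (p_s p_d : ℝ) : ℝ :=
  Real.sqrt ((N : ℝ) / K * (p_s * (1 - p_s)) + (N : ℝ) * ((K : ℝ) - 1) / K * (p_d * (1 - p_d)))

/-- The edge probability of the pair `i, j`: `p_s` within a community and `p_d` between different
communities. -/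
def edgeProb {N K : ℕ} (g : Fin N → Fin K) (p_s p_d : ℝ) (i j : Fin N) : ℝ :=
  if g i = g j then p_s else p_d

/-- `A` is the rescaled adjacency matrix of the stochastic block model with communities given by
`g`: a random real symmetric matrix with independent entries (up to symmetry), with
`A_ii = 0` almost surely and, for `i ≠ j`, `A_ij = 1/σ` with probability `p` and `A_ij = 0` with
probability `1 - p`, where `p` is the edge probability of the pair `i, j`. -/
structure IsRescaledSBM {Ω : Type*} [MeasurableSpace Ω] (P : Measure Ω) {N K : ℕ}
    (g : Fin N → Fin K) (p_s p_d : ℝ) (A : Ω → Matrix (Fin N) (Fin N) ℝ) : Prop where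
  symm : ∀ ω, (A ω).IsSymm
  measurable : ∀ i j, Measurable fun ω => A ω i j
  indep : iIndepFun (fun (e : {e : Fin N × Fin N // e.1 < e.2}) (ω : Ω) => A ω e.1.1 e.1.2) P
  diag : ∀ i, P {ω | A ω i i = 0} = 1
  edge : ∀ i j, i ≠ j →
    P {ω | A ω i j = 1 / scale N K p_s p_d} = ENNReal.ofReal (edgeProb g p_s p_d i j)
  nonedge : ∀ i j, i ≠ j →
    P {ω | A ω i j = 0} = ENNReal.ofReal (1 - edgeProb g p_s p_d i j)

/-- The entrywise expectation `E A`. -/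
def mean {Ω : Type*} [MeasurableSpace Ω] (P : Measure Ω) {N : ℕ}
    (A : Ω → Matrix (Fin N) (Fin N) ℝ) : Matrix (Fin N) (Fin N) ℝ :=
  Matrix.of fun i j => ∫ ω, A ω i j ∂P

/-- The centered matrix `A - E A`. -/
def centered {Ω : Type*} [MeasurableSpace Ω] (P : Measure Ω) {N : ℕ}
    (A : Ω → Matrix (Fin N) (Fin N) ℝ) (ω : Ω) : Matrix (Fin N) (Fin N) ℝ :=
  A ω - mean P A

end SparseSBM

end

/-! The matrix `A` is noise plus signal: almost surely it equals `hollowMatrix Z + expectedMatrix`,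
where the noise has independent centered entries of size at most 1/σ with row variances at most one,
and the signal is block constant off the diagonal. The normalization puts the noise spectrum in [-2
- o(1), 2 + o(1)], while the signal has K eigenvalues of size about 4 + δ or more, so a Weyl-type
bound leaves the top K eigenvalues above 2 by a fixed amount.

Noise: by Markov's inequality for the trace of an even power 2k, with k of order log N, it suffices
to bound the expected trace (`integral_trace_pow_le`). This is a sum over walks, estimated one step
at a time (`walkSum_le`). A first use of an edge costs its variance, and these sum to at most 1; a
second use is free; later uses cost a = 1/σ. If the edges used exactly once form a path ending at
the current vertex, there is one way to retrace, so a step contributes 1 + 1 = 2. Departure from a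
path is measured by `excess`, and the walk carries the potential `L ^ excess`. Choosing among
several single edges lowers the excess, which pays for the choice. Steps that may raise it lead to
visited vertices and cost only L³a² + L²a in total, negligible because σ is at least of order N^φ
and L is logarithmic.

Signal: on vectors with zero sum over every community, a space of codimension at most K, the form of
the mean is -p_s/σ times the squared norm, hence nonpositive; Courant-Fischer gives
`eigenvalue_le_noise`. On vectors constant on communities, of dimension K, it is at least 4 + δ up
to p_s/σ; subtracting the noise gives `signal_sub_noise_le_eigenvalue`. -/

namespace SparseSBM

/-! ### Counting weighted walks with a potential function -/

section WalkCounting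

variable {V : Type*} [LinearOrder V]

/-- Weight of an edge of variance `s` and size bound `a` which is used `m` times. -/
def edgeWeight (a s : ℝ) : ℕ → ℝ
  | 0 => 1
  | 1 => s
  | m + 2 => s * a ^ m

/-- Factor by which the weight of an edge changes when it is used once more. -/
def stepFactor (a s : ℝ) : ℕ → ℝ
  | 0 => s
  | 1 => 1
  | _ + 2 => a

lemma edgeWeight_succ (a s : ℝ) (m : ℕ) :
    edgeWeight a s (m + 1) = edgeWeight a s m * stepFactor a s m := by
  match m with
  | 0 => simp [edgeWeight, stepFactor]
  | 1 => simp [edgeWeight, stepFactor]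
  | m + 2 => simp only [edgeWeight, stepFactor]; ring

lemma edgeWeight_nonneg {a s : ℝ} (ha : 0 ≤ a) (hs : 0 ≤ s) (m : ℕ) : 0 ≤ edgeWeight a s m := by
  match m with
  | 0 => simp [edgeWeight]
  | 1 => simpa [edgeWeight] using hs
  | m + 2 => simp only [edgeWeight]; positivity

/-- Edge multiplicities after one more use of the edge `e`. -/
def addEdge (c : Sym2 V → ℕ) (e : Sym2 V) : Sym2 V → ℕ := Function.update c e (c e + 1)

lemma addEdge_self (c : Sym2 V → ℕ) (e : Sym2 V) : addEdge c e e = c e + 1 := by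
  simp [addEdge]

lemma addEdge_of_ne (c : Sym2 V → ℕ) {e e' : Sym2 V} (h : e' ≠ e) : addEdge c e e' = c e' := by
  simp [addEdge, h]

variable [Fintype V]

/-- Adding an edge changes a product over all pairs of vertices by a single factor. -/
lemma prod_addEdge {R : Type*} [CommMonoid R] (F : Sym2 V → ℕ → R) (c : Sym2 V → ℕ) {v w : V}
    (hvw : v ≠ w) (g : R)
    (hF : F s(v, w) (c s(v, w) + 1) = F s(v, w) (c s(v, w)) * g) :
    ∏ e : {e : V × V // e.1 < e.2}, F s(e.1.1, e.1.2) (addEdge c s(v, w) s(e.1.1, e.1.2)) =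
      (∏ e : {e : V × V // e.1 < e.2}, F s(e.1.1, e.1.2) (c s(e.1.1, e.1.2))) * g := by
  obtain ⟨e₀, he₀⟩ : ∃ e₀ : {e : V × V // e.1 < e.2}, s(e₀.1.1, e₀.1.2) = s(v, w) := by
    rcases lt_or_gt_of_ne hvw with h | h
    · exact ⟨⟨(v, w), h⟩, rfl⟩
    · exact ⟨⟨(w, v), h⟩, Sym2.eq_swap⟩
  rw [← Finset.mul_prod_erase _ _ (Finset.mem_univ e₀),
    ← Finset.mul_prod_erase (f := fun e : {e : V × V // e.1 < e.2} =>
      F s(e.1.1, e.1.2) (c s(e.1.1, e.1.2))) _ (Finset.mem_univ e₀), he₀, addEdge_self, hF,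
    mul_right_comm]
  congr 2
  refine Finset.prod_congr rfl fun e he => ?_
  rw [addEdge_of_ne]
  intro h
  refine (Finset.mem_erase.1 he).1 ?_
  rw [← he₀, Sym2.eq_iff] at h
  rcases h with h | h
  · exact Subtype.ext (Prod.ext h.1 h.2)
  · have h1 := e.2
    have h2 := e₀.2
    rw [h.1, h.2] at h1
    exact absurd h1 h2.not_gt

/-- Weight of a system of edge multiplicities. -/
def countWeight (a : ℝ) (s : Sym2 V → ℝ) (c : Sym2 V → ℕ) : ℝ :=
  ∏ e : {e : V × V // e.1 < e.2}, edgeWeight a (s s(e.1.1, e.1.2)) (c s(e.1.1, e.1.2))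

lemma countWeight_addEdge (a : ℝ) (s : Sym2 V → ℝ) (c : Sym2 V → ℕ) {v w : V} (hvw : v ≠ w) :
    countWeight a s (addEdge c s(v, w)) =
      countWeight a s c * stepFactor a (s s(v, w)) (c s(v, w)) :=
  prod_addEdge (fun e m => edgeWeight a (s e) m) c hvw _ (edgeWeight_succ _ _ _)

lemma countWeight_nonneg {a : ℝ} {s : Sym2 V → ℝ} (ha : 0 ≤ a) (hs : ∀ e, 0 ≤ s e)
    (c : Sym2 V → ℕ) : 0 ≤ countWeight a s c :=
  Finset.prod_nonneg fun _ _ => edgeWeight_nonneg ha (hs _) _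

/-- Total weight of all loopless walks of `r` steps from `v`, continuing multiplicities `c`. -/
def walkSum (a : ℝ) (s : Sym2 V → ℝ) : ℕ → (Sym2 V → ℕ) → V → ℝ
  | 0, c, _ => countWeight a s c
  | r + 1, c, v => ∑ w ∈ Finset.univ.erase v, walkSum a s r (addEdge c s(v, w)) w

/-- Number of edges at `x` that have been used exactly once. -/
def singleDegree (c : Sym2 V → ℕ) (x : V) : ℕ :=
  (Finset.univ.filter fun u => u ≠ x ∧ c s(x, u) = 1).card

/-- Amount by which the graph of the edges used exactly once differs from a path ending at `v`. -/
def excess (c : Sym2 V → ℕ) (v : V) : ℕ :=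
  ∑ x, (singleDegree c x - if x = v then 1 else 2)

lemma singleDegree_addEdge_of_ne (c : Sym2 V → ℕ) {v w x : V} (hv : x ≠ v) (hw : x ≠ w) :
    singleDegree (addEdge c s(v, w)) x = singleDegree c x := by
  unfold singleDegree
  congr 1
  refine Finset.filter_congr fun u _ => ?_
  rw [addEdge_of_ne]
  intro h
  rw [Sym2.eq_iff] at h
  tauto

lemma singleDegree_addEdge_new {c : Sym2 V → ℕ} {v w : V} (hvw : v ≠ w) (h : c s(v, w) = 0) :
    singleDegree (addEdge c s(v, w)) v = singleDegree c v + 1 := by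
  unfold singleDegree
  rw [← Finset.card_insert_of_notMem (a := w) (by simp [h])]
  congr 1
  ext u
  simp only [Finset.mem_filter, Finset.mem_univ, true_and, Finset.mem_insert]
  by_cases hu : u = w
  · subst hu; simp [addEdge_self, h, hvw.symm]
  · rw [addEdge_of_ne]
    · simp [hu]
    · rw [Ne, Sym2.congr_right]; exact hu

lemma singleDegree_addEdge_single {c : Sym2 V → ℕ} {v w : V} (hvw : v ≠ w)
    (h : c s(v, w) = 1) :
    singleDegree (addEdge c s(v, w)) v + 1 = singleDegree c v := by
  unfold singleDegree
  rw [← Finset.card_insert_of_notMem (a := w) (by simp [h, addEdge_self])]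
  congr 1
  ext u
  simp only [Finset.mem_filter, Finset.mem_univ, true_and, Finset.mem_insert]
  by_cases hu : u = w
  · subst hu; simp [h, hvw.symm]
  · rw [addEdge_of_ne]
    · simp [hu]
    · rw [Ne, Sym2.congr_right]; exact hu

lemma singleDegree_addEdge_multiple {c : Sym2 V → ℕ} {v w : V} (h : 2 ≤ c s(v, w)) (x : V) :
    singleDegree (addEdge c s(v, w)) x = singleDegree c x := by
  unfold singleDegree
  congr 1
  refine Finset.filter_congr fun u _ => ?_
  by_cases hu : s(x, u) = s(v, w)
  · rw [hu, addEdge_self]; omega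
  · rw [addEdge_of_ne _ hu]

lemma excess_eq (c : Sym2 V → ℕ) {v w : V} (hvw : v ≠ w) :
    excess c v = (singleDegree c v - 1) + (singleDegree c w - 2) +
      ∑ x ∈ (Finset.univ.erase v).erase w, (singleDegree c x - 2) := by
  unfold excess
  rw [← Finset.add_sum_erase _ _ (Finset.mem_univ v),
    ← Finset.add_sum_erase _ _ (Finset.mem_erase.2 ⟨hvw.symm, Finset.mem_univ w⟩), add_assoc]
  simp only [if_true, if_neg hvw.symm]
  congr 2
  refine Finset.sum_congr rfl fun x hx => ?_
  simp only [Finset.mem_erase] at hx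
  rw [if_neg hx.2.1]

lemma excess_addEdge_eq (c : Sym2 V → ℕ) {v w : V} (hvw : v ≠ w) :
    excess (addEdge c s(v, w)) w = (singleDegree (addEdge c s(v, w)) v - 2) +
      (singleDegree (addEdge c s(v, w)) w - 1) +
      ∑ x ∈ (Finset.univ.erase v).erase w, (singleDegree c x - 2) := by
  rw [excess_eq _ hvw.symm, Finset.erase_right_comm,
    add_comm (singleDegree (addEdge c s(v, w)) v - 2)]
  congr 1
  refine Finset.sum_congr rfl fun x hx => ?_
  simp only [Finset.mem_erase] at hx
  rw [singleDegree_addEdge_of_ne _ hx.2.1 hx.1]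

/-- The allowance at `v` rises from 1 to 2 together with its degree, so `v` contributes the same. At
`w` the degree rises while the allowance falls, which costs at most 2, and nothing if `w` had no
single edge: the path has merely been prolonged. -/
lemma excess_addEdge_new {c : Sym2 V → ℕ} {v w : V} (hvw : v ≠ w) (h : c s(v, w) = 0) :
    excess (addEdge c s(v, w)) w ≤ excess c v + 2 ∧
      (singleDegree c w = 0 → excess (addEdge c s(v, w)) w ≤ excess c v) := by
  have h1 := singleDegree_addEdge_new hvw h
  have h2 := singleDegree_addEdge_new hvw.symm (by rwa [Sym2.eq_swap])
  rw [Sym2.eq_swap] at h2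
  rw [excess_addEdge_eq c hvw, excess_eq c hvw]
  omega

/-- Retracing a single edge deletes it from the graph of single edges. At `w` degree and allowance
both drop by one; at `v` the degree drops while the allowance rises, a strict gain whenever there
was a real choice of edge. -/
lemma excess_addEdge_single {c : Sym2 V → ℕ} {v w : V} (hvw : v ≠ w) (h : c s(v, w) = 1) :
    excess (addEdge c s(v, w)) w ≤ excess c v ∧
      (2 ≤ singleDegree c v → excess (addEdge c s(v, w)) w + 1 ≤ excess c v) := by
  have h1 := singleDegree_addEdge_single hvw h
  have h2 := singleDegree_addEdge_single hvw.symm (by rwa [Sym2.eq_swap])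
  rw [Sym2.eq_swap] at h2
  rw [excess_addEdge_eq c hvw, excess_eq c hvw]
  omega

/-- The single edges do not change; only the endpoint moves, and its smaller allowance costs at most
1. -/
lemma excess_addEdge_multiple {c : Sym2 V → ℕ} {v w : V} (hvw : v ≠ w) (h : 2 ≤ c s(v, w)) :
    excess (addEdge c s(v, w)) w ≤ excess c v + 1 := by
  rw [excess_addEdge_eq c hvw, excess_eq c hvw, singleDegree_addEdge_multiple h,
    singleDegree_addEdge_multiple h]
  omega

lemma singleDegree_le_card {c : Sym2 V → ℕ} {S : Finset V}
    (hc : ∀ x y, c s(x, y) ≠ 0 → y ∈ S) (x : V) : singleDegree c x ≤ S.card := by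
  refine Finset.card_le_card fun u hu => ?_
  simp only [Finset.mem_filter, Finset.mem_univ, true_and] at hu
  exact hc x u (by omega)

lemma mem_of_singleDegree_ne_zero {c : Sym2 V → ℕ} {S : Finset V}
    (hc : ∀ x y, c s(x, y) ≠ 0 → y ∈ S) {x : V} (hx : singleDegree c x ≠ 0) : x ∈ S := by
  obtain ⟨u, hu⟩ := Finset.card_ne_zero.1 hx
  simp only [Finset.mem_filter, Finset.mem_univ, true_and] at hu
  exact hc u x (by rw [Sym2.eq_swap]; omega)

/-- One step of the walk, with the excess as potential. -/
lemma stepFactor_mul_pow_excess_le {a b : ℝ} {s : Sym2 V → ℝ} (ha : 0 ≤ a) (hs : ∀ e, 0 ≤ s e)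
    (hb : ∀ e, s e ≤ b) {c : Sym2 V → ℕ} {S : Finset V} {L : ℕ}
    (hc : ∀ x y, c s(x, y) ≠ 0 → y ∈ S) (hL : S.card ≤ L) (hL1 : 1 ≤ L) {v w : V} (hvw : v ≠ w) :
    stepFactor a (s s(v, w)) (c s(v, w)) * (L : ℝ) ^ excess (addEdge c s(v, w)) w ≤
      (s s(v, w) + (if w ∈ S then b * (L : ℝ) ^ 2 + a * L else 0) +
        (if c s(v, w) = 1 then 1 / (singleDegree c v : ℝ) else 0)) * (L : ℝ) ^ excess c v := by
  have hL0 : (1 : ℝ) ≤ L := by exact_mod_cast hL1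
  have hb0 : 0 ≤ b := (hs s(v, w)).trans (hb _)
  have hs0 := hs s(v, w)
  have hp : 0 < (L : ℝ) ^ excess c v := by positivity
  rcases Nat.lt_or_ge (c s(v, w)) 1 with h | h
  · have h0 : c s(v, w) = 0 := by omega
    obtain ⟨h2, h3⟩ := excess_addEdge_new hvw h0
    simp only [h0, stepFactor]
    by_cases hd : singleDegree c w = 0
    · have : (L : ℝ) ^ excess (addEdge c s(v, w)) w ≤ (L : ℝ) ^ excess c v :=
        pow_le_pow_right₀ hL0 (h3 hd)
      refine (mul_le_mul_of_nonneg_left this hs0).trans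
        (mul_le_mul_of_nonneg_right ?_ hp.le)
      have : 0 ≤ (if w ∈ S then b * (L : ℝ) ^ 2 + a * L else 0) := by
        split_ifs <;> positivity
      simpa using this
    · have hw := mem_of_singleDegree_ne_zero hc hd
      have : (L : ℝ) ^ excess (addEdge c s(v, w)) w ≤ (L : ℝ) ^ 2 * (L : ℝ) ^ excess c v := by
        rw [← pow_add, add_comm 2]; exact pow_le_pow_right₀ hL0 h2
      calc s s(v, w) * (L : ℝ) ^ excess (addEdge c s(v, w)) w
          ≤ b * ((L : ℝ) ^ 2 * (L : ℝ) ^ excess c v) := by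
            gcongr; exact hb _
        _ = (b * (L : ℝ) ^ 2) * (L : ℝ) ^ excess c v := by ring
        _ ≤ _ := by
            refine mul_le_mul_of_nonneg_right ?_ hp.le
            rw [if_pos hw]
            have : 0 ≤ a * L := by positivity
            simp only [zero_ne_one, if_false]
            linarith
  rcases Nat.lt_or_ge (c s(v, w)) 2 with h' | h'
  · have h1 : c s(v, w) = 1 := by omega
    obtain ⟨h2, h3⟩ := excess_addEdge_single hvw h1
    simp only [h1, stepFactor, one_mul, if_true]
    have hd : 1 ≤ singleDegree c v := by
      have := singleDegree_addEdge_single hvw h1; omega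
    have hd' : (0 : ℝ) < singleDegree c v := by exact_mod_cast hd
    suffices hmain : (L : ℝ) ^ excess (addEdge c s(v, w)) w ≤
        1 / (singleDegree c v : ℝ) * (L : ℝ) ^ excess c v by
      refine hmain.trans (mul_le_mul_of_nonneg_right ?_ hp.le)
      have : 0 ≤ (if w ∈ S then b * (L : ℝ) ^ 2 + a * L else 0) := by
        split_ifs <;> positivity
      linarith
    rcases Nat.lt_or_ge (singleDegree c v) 2 with hd2 | hd2
    · have : singleDegree c v = 1 := by omega
      rw [this]
      simpa using pow_le_pow_right₀ hL0 h2
    -- The excess drops by at least one, gaining a factor L, and L bounds the number of single edges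
    -- at `v`.
    · rw [div_mul_eq_mul_div, one_mul, le_div_iff₀ hd']
      calc (L : ℝ) ^ excess (addEdge c s(v, w)) w * singleDegree c v
          ≤ (L : ℝ) ^ excess (addEdge c s(v, w)) w * L := by
            gcongr
            exact_mod_cast (singleDegree_le_card hc v).trans hL
        _ = (L : ℝ) ^ (excess (addEdge c s(v, w)) w + 1) := (pow_succ _ _).symm
        _ ≤ _ := pow_le_pow_right₀ hL0 (h3 hd2)
  · have hw : w ∈ S := hc v w (by omega)
    have h2 := excess_addEdge_multiple hvw h'
    obtain ⟨m, hm⟩ := Nat.exists_eq_add_of_le' h'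
    simp only [hm, stepFactor]
    have : (L : ℝ) ^ excess (addEdge c s(v, w)) w ≤ L * (L : ℝ) ^ excess c v := by
      rw [← pow_succ']; exact pow_le_pow_right₀ hL0 h2
    calc a * (L : ℝ) ^ excess (addEdge c s(v, w)) w
        ≤ a * (L * (L : ℝ) ^ excess c v) := by gcongr
      _ = (a * L) * (L : ℝ) ^ excess c v := by ring
      _ ≤ _ := by
          refine mul_le_mul_of_nonneg_right ?_ hp.le
          rw [if_pos hw, if_neg (by omega)]
          have : 0 ≤ b * (L : ℝ) ^ 2 := by positivity
          linarith

/-- Walks of `r` steps weigh at most `(2 + small) ^ r`, up to a factor for the excess. -/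
theorem walkSum_le {a b : ℝ} {s : Sym2 V → ℝ} (ha : 0 ≤ a) (hs : ∀ e, 0 ≤ s e)
    (hb : ∀ e, s e ≤ b) (hrow : ∀ v, ∑ w ∈ Finset.univ.erase v, s s(v, w) ≤ 1) {L : ℕ}
    (r : ℕ) : ∀ (c : Sym2 V → ℕ) (v : V) (S : Finset V), v ∈ S →
    (∀ x y, c s(x, y) ≠ 0 → y ∈ S) → S.card + r ≤ L →
    walkSum a s r c v ≤ countWeight a s c *
      ((2 + (L : ℝ) ^ 3 * b + (L : ℝ) ^ 2 * a) ^ r * (L : ℝ) ^ excess c v) := by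
  induction r with
  | zero =>
    intro c v S hv _ hSL
    have h1 : 1 ≤ S.card := Finset.card_pos.2 ⟨v, hv⟩
    have hL0 : (1 : ℝ) ≤ L := by exact_mod_cast (by omega : 1 ≤ L)
    simp only [walkSum, pow_zero, one_mul]
    exact le_mul_of_one_le_right (countWeight_nonneg ha hs c) (one_le_pow₀ hL0)
  | succ r ih =>
    intro c v S hv hc hSL
    have h1 : 1 ≤ S.card := Finset.card_pos.2 ⟨v, hv⟩
    have hL1 : 1 ≤ L := by omega
    have hb0 : 0 ≤ b := (hs s(v, v)).trans (hb _)
    set G : ℝ := 2 + (L : ℝ) ^ 3 * b + (L : ℝ) ^ 2 * a with hG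
    have hG0 : 0 ≤ G := by positivity
    set τ : V → ℝ := fun w => s s(v, w) + (if w ∈ S then b * (L : ℝ) ^ 2 + a * L else 0) +
        (if c s(v, w) = 1 then 1 / (singleDegree c v : ℝ) else 0) with hτ
    have hstep : ∀ w ∈ Finset.univ.erase v, walkSum a s r (addEdge c s(v, w)) w ≤
        (countWeight a s c * (G ^ r * (L : ℝ) ^ excess c v)) * τ w := by
      intro w hw
      have hvw : v ≠ w := (Finset.ne_of_mem_erase hw).symm
      -- The set of visited vertices gains at most one element while one step is spent, so the same
      -- L serves throughout.
      have h2 := ih (addEdge c s(v, w)) w (insert w S) (Finset.mem_insert_self _ _)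
        (by
          intro x y hxy
          by_cases he : s(x, y) = s(v, w)
          · rw [Sym2.eq_iff] at he
            rcases he with he | he
            · simp [he.2]
            · simp [he.2, hv]
          · rw [addEdge_of_ne _ he] at hxy
            exact Finset.mem_insert_of_mem (hc x y hxy))
        (by have := Finset.card_insert_le w S; omega)
      refine h2.trans ?_
      rw [countWeight_addEdge _ _ _ hvw]
      have h3 := stepFactor_mul_pow_excess_le ha hs hb hc (by omega : S.card ≤ L) hL1 hvw
      have h4 : 0 ≤ countWeight a s c * G ^ r :=
        mul_nonneg (countWeight_nonneg ha hs c) (pow_nonneg hG0 _)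
      calc _ = (countWeight a s c * G ^ r) * (stepFactor a (s s(v, w)) (c s(v, w)) *
              (L : ℝ) ^ excess (addEdge c s(v, w)) w) := by ring
        _ ≤ (countWeight a s c * G ^ r) * (τ w * (L : ℝ) ^ excess c v) :=
            mul_le_mul_of_nonneg_left h3 h4
        _ = _ := by ring
    have hτsum : ∑ w ∈ Finset.univ.erase v, τ w ≤ G := by
      simp only [hτ, Finset.sum_add_distrib]
      have e2 : ∑ w ∈ Finset.univ.erase v, (if w ∈ S then b * (L : ℝ) ^ 2 + a * L else 0) ≤
          L * (b * (L : ℝ) ^ 2 + a * L) := by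
        rw [← Finset.sum_filter, Finset.sum_const, nsmul_eq_mul]
        gcongr
        refine (Finset.card_le_card (t := S) fun x hx => (Finset.mem_filter.1 hx).2).trans ?_
        omega
      -- Exactly d choices of weight 1/d; if d = 0 the sum is empty and the quotient is 0 by
      -- convention.
      have e3 : ∑ w ∈ Finset.univ.erase v,
          (if c s(v, w) = 1 then 1 / (singleDegree c v : ℝ) else 0) ≤ 1 := by
        rw [← Finset.sum_filter, Finset.sum_const, nsmul_eq_mul]
        have : ((Finset.univ.erase v).filter fun w => c s(v, w) = 1).card = singleDegree c v := by
          unfold singleDegree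
          congr 1
          ext u; simp
        rw [this, mul_one_div]
        exact div_self_le_one _
      have := hrow v
      rw [hG]
      nlinarith
    simp only [walkSum]
    refine (Finset.sum_le_sum hstep).trans ?_
    rw [← Finset.mul_sum]
    have h5 : 0 ≤ countWeight a s c * (G ^ r * (L : ℝ) ^ excess c v) :=
      mul_nonneg (countWeight_nonneg ha hs c) (by positivity)
    refine (mul_le_mul_of_nonneg_left hτsum h5).trans (le_of_eq ?_)
    ring

lemma walkSum_zero_le {a b : ℝ} {s : Sym2 V → ℝ} (ha : 0 ≤ a) (hs : ∀ e, 0 ≤ s e)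
    (hb : ∀ e, s e ≤ b) (hrow : ∀ v, ∑ w ∈ Finset.univ.erase v, s s(v, w) ≤ 1) (r : ℕ) (v : V) :
    walkSum a s r (fun _ => 0) v ≤
      (2 + ((r + 1 : ℕ) : ℝ) ^ 3 * b + ((r + 1 : ℕ) : ℝ) ^ 2 * a) ^ r := by
  have h := walkSum_le ha hs hb hrow (L := r + 1) r (fun _ => 0) v {v} (by simp) (by simp)
    (by simp [add_comm])
  have h1 : countWeight a s (fun _ => 0) = 1 := by simp [countWeight, edgeWeight]
  have h2 : excess (fun _ => 0) v = 0 := by simp [excess, singleDegree]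
  rwa [h1, h2, one_mul, pow_zero, mul_one] at h

end WalkCounting

/-! ### From trace moments to walk sums -/

section TraceMoments

variable {Ω : Type*} [MeasurableSpace Ω] {V : Type*} [LinearOrder V]

/-- Bounded measurable real functions. -/
def BoundedMeasurable (f : Ω → ℝ) : Prop := Measurable f ∧ ∃ C, ∀ ω, |f ω| ≤ C

lemma BoundedMeasurable.integrable {P : Measure Ω} [IsProbabilityMeasure P] {f : Ω → ℝ}
    (hf : BoundedMeasurable f) : Integrable f P := by
  obtain ⟨hm, C, hC⟩ := hf
  exact Integrable.of_bound hm.aestronglyMeasurable C (Filter.Eventually.of_forall hC)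

lemma boundedMeasurable_const (x : ℝ) : BoundedMeasurable fun _ : Ω => x :=
  ⟨measurable_const, |x|, fun _ => le_rfl⟩

lemma BoundedMeasurable.mul {f g : Ω → ℝ} (hf : BoundedMeasurable f) (hg : BoundedMeasurable g) :
    BoundedMeasurable fun ω => f ω * g ω := by
  obtain ⟨hm, C, hC⟩ := hf
  obtain ⟨hm', C', hC'⟩ := hg
  refine ⟨hm.mul hm', C * C', fun ω => ?_⟩
  rw [abs_mul]
  exact mul_le_mul (hC ω) (hC' ω) (abs_nonneg _) ((abs_nonneg _).trans (hC ω))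

lemma BoundedMeasurable.pow {f : Ω → ℝ} (hf : BoundedMeasurable f) (m : ℕ) :
    BoundedMeasurable fun ω => f ω ^ m := by
  induction m with
  | zero => simpa using boundedMeasurable_const 1
  | succ m ih => simpa only [pow_succ] using ih.mul hf

lemma BoundedMeasurable.sum {ι : Type*} {s : Finset ι} {f : ι → Ω → ℝ}
    (hf : ∀ i ∈ s, BoundedMeasurable (f i)) : BoundedMeasurable fun ω => ∑ i ∈ s, f i ω := by
  classical
  induction s using Finset.induction_on with
  | empty => simpa using boundedMeasurable_const 0
  | insert i s his ih =>
    obtain ⟨hm, C, hC⟩ := hf i (Finset.mem_insert_self _ _)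
    obtain ⟨hm', C', hC'⟩ := ih fun j hj => hf j (Finset.mem_insert_of_mem hj)
    simp only [Finset.sum_insert his]
    exact ⟨hm.add hm', C + C', fun ω => (abs_add_le _ _).trans (add_le_add (hC ω) (hC' ω))⟩

lemma BoundedMeasurable.prod {ι : Type*} {s : Finset ι} {f : ι → Ω → ℝ}
    (hf : ∀ i ∈ s, BoundedMeasurable (f i)) : BoundedMeasurable fun ω => ∏ i ∈ s, f i ω := by
  classical
  induction s using Finset.induction_on with
  | empty => simpa using boundedMeasurable_const 1
  | insert i s his ih =>
    simp only [Finset.prod_insert his]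
    exact (hf i (Finset.mem_insert_self _ _)).mul
      (ih fun j hj => hf j (Finset.mem_insert_of_mem hj))

/-- The symmetric matrix with zero diagonal and off-diagonal entries `z s(i, j)`. -/
def hollowMatrix (z : Sym2 V → ℝ) : Matrix V V ℝ :=
  Matrix.of fun i j => if i = j then 0 else z s(i, j)

lemma hollowMatrix_isHermitian (z : Sym2 V → ℝ) : (hollowMatrix z).IsHermitian := by
  ext i j
  simp only [hollowMatrix, Matrix.conjTranspose_apply, Matrix.of_apply, eq_comm (a := j),
    Sym2.eq_swap (a := j), star_trivial]

variable [Fintype V]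

lemma hollowMatrix_pow_succ_apply (z : Sym2 V → ℝ) (r : ℕ) (v u : V) :
    (hollowMatrix z ^ (r + 1)) v u =
      ∑ w ∈ Finset.univ.erase v, z s(v, w) * (hollowMatrix z ^ r) w u := by
  rw [pow_succ', Matrix.mul_apply, ← Finset.add_sum_erase _ _ (Finset.mem_univ v)]
  have : hollowMatrix z v v = 0 := by simp [hollowMatrix]
  rw [this, zero_mul, zero_add]
  refine Finset.sum_congr rfl fun w hw => ?_
  simp [hollowMatrix, (Finset.ne_of_mem_erase hw).symm]

lemma boundedMeasurable_hollowMatrix_pow {Z : Sym2 V → Ω → ℝ}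
    (hZ : ∀ e, BoundedMeasurable (Z e)) (r : ℕ) : ∀ v u,
    BoundedMeasurable fun ω => (hollowMatrix (fun e => Z e ω) ^ r) v u := by
  induction r with
  | zero => intro v u; simpa using boundedMeasurable_const _
  | succ r ih =>
    intro v u
    simp only [hollowMatrix_pow_succ_apply]
    exact BoundedMeasurable.sum fun w _ => (hZ _).mul (ih w u)

/-- The monomial with exponents `c` in the entries above the diagonal. -/
def edgeMonomial (z : Sym2 V → ℝ) (c : Sym2 V → ℕ) : ℝ :=
  ∏ e : {e : V × V // e.1 < e.2}, z s(e.1.1, e.1.2) ^ c s(e.1.1, e.1.2)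

lemma edgeMonomial_addEdge (z : Sym2 V → ℝ) (c : Sym2 V → ℕ) {v w : V} (hvw : v ≠ w) :
    edgeMonomial z (addEdge c s(v, w)) = edgeMonomial z c * z s(v, w) :=
  prod_addEdge (fun e m => z e ^ m) c hvw _ (pow_succ _ _)

/-- For m = 1 the integral vanishes, but the bound keeps the variance instead of 0. Then the weights
evolve by finite factors along a walk: the variance at the first use, 1 at the second, a afterwards.
-/
lemma abs_integral_pow_le {P : Measure Ω} [IsProbabilityMeasure P] {Y : Ω → ℝ} {a : ℝ}
    (hm : Measurable Y) (ha : ∀ ω, |Y ω| ≤ a) (h0 : ∫ ω, Y ω ∂P = 0) (m : ℕ) :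
    |∫ ω, Y ω ^ m ∂P| ≤ edgeWeight a (∫ ω, Y ω ^ 2 ∂P) m := by
  have hB : BoundedMeasurable Y := ⟨hm, a, ha⟩
  match m with
  | 0 => simp [edgeWeight]
  | 1 =>
    simp only [edgeWeight, pow_one, h0, abs_zero]
    exact integral_nonneg fun ω => sq_nonneg _
  | m + 2 =>
    simp only [edgeWeight]
    refine abs_integral_le_integral_abs.trans ?_
    rw [← integral_mul_const]
    refine integral_mono (hB.pow _).integrable.abs ((hB.pow 2).integrable.mul_const _) fun ω => ?_
    simp only [abs_pow]
    rw [pow_add, mul_comm, sq_abs]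
    gcongr
    exact ha ω

lemma abs_integral_edgeMonomial_le {P : Measure Ω} [IsProbabilityMeasure P]
    {Z : Sym2 V → Ω → ℝ} {a : ℝ} (hm : ∀ e, Measurable (Z e)) (ha : ∀ e ω, |Z e ω| ≤ a)
    (h0 : ∀ e, ∫ ω, Z e ω ∂P = 0)
    (hind : iIndepFun (fun (e : {e : V × V // e.1 < e.2}) => Z s(e.1.1, e.1.2)) P)
    (c : Sym2 V → ℕ) :
    |∫ ω, edgeMonomial (fun e => Z e ω) c ∂P| ≤
      countWeight a (fun e => ∫ ω, Z e ω ^ 2 ∂P) c := by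
  unfold edgeMonomial countWeight
  rw [hind.integral_fun_prod_comp
    (f := fun (e : {e : V × V // e.1 < e.2}) x => x ^ c s(e.1.1, e.1.2))
    (fun e => (hm _).aemeasurable) (fun e => (measurable_id.pow_const _).aestronglyMeasurable),
    Finset.abs_prod]
  exact Finset.prod_le_prod (fun _ _ => abs_nonneg _)
    fun e _ => abs_integral_pow_le (hm _) (ha _) (h0 _) _

/-- The monomial records the steps already taken, which makes induction on the remaining length
possible. The requirement that the walk end at `u` is dropped, since `walkSum` leaves the endpoint
free. -/
lemma abs_integral_edgeMonomial_mul_pow_le {P : Measure Ω} [IsProbabilityMeasure P]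
    {Z : Sym2 V → Ω → ℝ} {a : ℝ} (ha0 : 0 ≤ a)
    (hm : ∀ e, Measurable (Z e)) (ha : ∀ e ω, |Z e ω| ≤ a)
    (h0 : ∀ e, ∫ ω, Z e ω ∂P = 0)
    (hind : iIndepFun (fun (e : {e : V × V // e.1 < e.2}) => Z s(e.1.1, e.1.2)) P) (u : V)
    (r : ℕ) : ∀ (c : Sym2 V → ℕ) (v : V),
    |∫ ω, edgeMonomial (fun e => Z e ω) c * (hollowMatrix (fun e => Z e ω) ^ r) v u ∂P| ≤
      walkSum a (fun e => ∫ ω, Z e ω ^ 2 ∂P) r c v := by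
  have hB : ∀ e, BoundedMeasurable (Z e) := fun e => ⟨hm e, a, ha e⟩
  have hmon : ∀ c, BoundedMeasurable fun ω => edgeMonomial (fun e => Z e ω) c :=
    fun c => BoundedMeasurable.prod fun e _ => (hB _).pow _
  induction r with
  | zero =>
    intro c v
    simp only [pow_zero, walkSum, Matrix.one_apply]
    split_ifs
    · simpa using abs_integral_edgeMonomial_le hm ha h0 hind c
    · simpa using countWeight_nonneg ha0
        (fun e => integral_nonneg fun ω => sq_nonneg (Z e ω)) c
  | succ r ih =>
    intro c v
    have hexp : ∀ ω, edgeMonomial (fun e => Z e ω) c *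
        (hollowMatrix (fun e => Z e ω) ^ (r + 1)) v u =
        ∑ w ∈ Finset.univ.erase v, edgeMonomial (fun e => Z e ω) (addEdge c s(v, w)) *
          (hollowMatrix (fun e => Z e ω) ^ r) w u := by
      intro ω
      rw [hollowMatrix_pow_succ_apply, Finset.mul_sum]
      refine Finset.sum_congr rfl fun w hw => ?_
      rw [edgeMonomial_addEdge _ _ (Finset.ne_of_mem_erase hw).symm, mul_assoc]
    simp only [hexp]
    rw [integral_finsetSum _ fun w _ =>
      ((hmon _).mul (boundedMeasurable_hollowMatrix_pow hB r w u)).integrable]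
    exact (Finset.abs_sum_le_sum_abs _ _).trans (Finset.sum_le_sum fun w _ => ih _ _)

/-- High trace moments of a random symmetric matrix with independent centered entries bounded by
`a` and rows of variance at most one. -/
theorem integral_trace_pow_le {P : Measure Ω} [IsProbabilityMeasure P]
    {Z : Sym2 V → Ω → ℝ} {a : ℝ} (ha0 : 0 ≤ a)
    (hm : ∀ e, Measurable (Z e)) (ha : ∀ e ω, |Z e ω| ≤ a)
    (h0 : ∀ e, ∫ ω, Z e ω ∂P = 0)
    (hind : iIndepFun (fun (e : {e : V × V // e.1 < e.2}) => Z s(e.1.1, e.1.2)) P)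
    (hrow : ∀ v, ∑ w ∈ Finset.univ.erase v, ∫ ω, Z s(v, w) ω ^ 2 ∂P ≤ 1) (r : ℕ) :
    ∫ ω, (hollowMatrix (fun e => Z e ω) ^ r).trace ∂P ≤
      Fintype.card V * (2 + ((r + 1 : ℕ) : ℝ) ^ 3 * a ^ 2 + ((r + 1 : ℕ) : ℝ) ^ 2 * a) ^ r := by
  have hB : ∀ e, BoundedMeasurable (Z e) := fun e => ⟨hm e, a, ha e⟩
  simp only [Matrix.trace, Matrix.diag]
  rw [integral_finsetSum _ fun v _ => (boundedMeasurable_hollowMatrix_pow hB r v v).integrable,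
    ← nsmul_eq_mul, ← Finset.card_univ]
  refine Finset.sum_le_card_nsmul _ _ _ fun v _ => (le_abs_self _).trans ?_
  have h1 := abs_integral_edgeMonomial_mul_pow_le ha0 hm ha h0 hind v r (fun _ => 0) v
  simp only [edgeMonomial, pow_zero, Finset.prod_const_one, one_mul] at h1
  refine h1.trans (walkSum_zero_le ha0 (fun e => integral_nonneg fun ω => sq_nonneg (Z e ω))
    (fun e => ?_) hrow r v)
  have h2 : ∫ ω, Z e ω ^ 2 ∂P ≤ ∫ _, a ^ 2 ∂P :=
    integral_mono ((hB e).pow 2).integrable (integrable_const _)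
      fun ω => sq_le_sq' (by have := abs_le.1 (ha e ω); linarith) (abs_le.1 (ha e ω)).2
  simpa using h2

lemma boundedMeasurable_trace_hollowMatrix_pow {Z : Sym2 V → Ω → ℝ}
    (hZ : ∀ e, BoundedMeasurable (Z e)) (r : ℕ) :
    BoundedMeasurable fun ω => (hollowMatrix (fun e => Z e ω) ^ r).trace :=
  BoundedMeasurable.sum fun v _ => boundedMeasurable_hollowMatrix_pow hZ r v v

end TraceMoments

/-! ### Variational principles and traces for ordered eigenvalues -/

section Eigenvalues

variable {N : ℕ} {M : Matrix (Fin N) (Fin N) ℝ}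

lemma eigenvalue_succ (hM : M.IsHermitian) (i : Fin N) :
    eigenvalue M (i + 1) = hM.eigenvalues₀ (finCongr (Fintype.card_fin N).symm i) := by
  unfold eigenvalue
  rw [dif_pos ⟨hM, by omega, by omega⟩]
  rfl

lemma eigenvalue_anti (hM : M.IsHermitian) {i j : ℕ} (hi : 1 ≤ i) (hij : i ≤ j) (hj : j ≤ N) :
    eigenvalue M j ≤ eigenvalue M i := by
  unfold eigenvalue
  rw [dif_pos ⟨hM, by omega, by omega⟩, dif_pos ⟨hM, by omega, by omega⟩]
  exact hM.eigenvalues₀_antitone (by simp only [Fin.mk_le_mk]; omega)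

/-- Coordinates in an orthonormal basis of eigenvectors. -/
lemma exists_eigenvalue_coordinates (hM : M.IsHermitian) :
    ∃ e : (Fin N → ℝ) ≃ₗ[ℝ] (Fin N → ℝ), (∀ x, x ⬝ᵥ x = ∑ i, e x i ^ 2) ∧
      ∀ x, x ⬝ᵥ M.mulVec x = ∑ i : Fin N, eigenvalue M (i + 1) * e x i ^ 2 := by
  have hT := Matrix.isSymmetric_toEuclideanLin_iff.mpr hM
  set b := hT.eigenvectorBasis finrank_euclideanSpace with hb
  set σ := finCongr (Fintype.card_fin N).symm with hσ
  have hdot : ∀ x y : Fin N → ℝ, x ⬝ᵥ y =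
      ∑ i, b.repr (WithLp.toLp 2 x) (σ i) * b.repr (WithLp.toLp 2 y) (σ i) := by
    intro x y
    rw [Equiv.sum_comp σ fun i => b.repr (WithLp.toLp 2 x) i * b.repr (WithLp.toLp 2 y) i]
    have h1 : x ⬝ᵥ y = inner ℝ (WithLp.toLp 2 x) (WithLp.toLp 2 y : EuclideanSpace ℝ (Fin N)) := by
      simp [EuclideanSpace.inner_eq_star_dotProduct, dotProduct_comm]
    rw [h1, ← b.repr.inner_map_map, PiLp.inner_apply]
    simp [mul_comm]
  refine ⟨(WithLp.linearEquiv 2 ℝ (Fin N → ℝ)).symm.trans (b.repr.toLinearEquiv.trans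
    ((WithLp.linearEquiv 2 ℝ _).trans (LinearEquiv.funCongrLeft ℝ ℝ σ))), fun x => ?_, fun x => ?_⟩
  · rw [hdot]
    exact Finset.sum_congr rfl fun i _ => (sq _).symm
  · rw [hdot]
    refine Finset.sum_congr rfl fun i _ => ?_
    have h2 := hT.eigenvectorBasis_apply_self_apply finrank_euclideanSpace (WithLp.toLp 2 x) (σ i)
    rw [Matrix.toLpLin_apply] at h2
    rw [eigenvalue_succ hM]
    refine (congrArg (b.repr (WithLp.toLp 2 x) (σ i) * ·) h2).trans ?_
    change _ = _ * (b.repr (WithLp.toLp 2 x) (σ i)) ^ 2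
    rw [sq, mul_left_comm]
    rfl

lemma dotProduct_mulVec_le_eigenvalue_one (hM : M.IsHermitian) (x : Fin N → ℝ) :
    x ⬝ᵥ M.mulVec x ≤ eigenvalue M 1 * (x ⬝ᵥ x) := by
  obtain ⟨e, h1, h2⟩ := exists_eigenvalue_coordinates hM
  rw [h1, h2, Finset.mul_sum]
  exact Finset.sum_le_sum fun i _ => mul_le_mul_of_nonneg_right
    (eigenvalue_anti hM le_rfl (by omega) (by omega)) (sq_nonneg _)

lemma le_dotProduct_mulVec_of_le_eigenvalue (hM : M.IsHermitian) {t : ℝ}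
    (ht : ∀ i : Fin N, t ≤ eigenvalue M (i + 1)) (x : Fin N → ℝ) :
    t * (x ⬝ᵥ x) ≤ x ⬝ᵥ M.mulVec x := by
  obtain ⟨e, h1, h2⟩ := exists_eigenvalue_coordinates hM
  rw [h1, h2, Finset.mul_sum]
  exact Finset.sum_le_sum fun i _ => mul_le_mul_of_nonneg_right (ht i) (sq_nonneg _)

/-- Courant-Fischer upper bound: a bound for the quadratic form on a subspace of codimension at
most `m` bounds all but the `m` largest eigenvalues. -/
lemma eigenvalue_le_of_ker (hM : M.IsHermitian) {m : ℕ}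
    (f : (Fin N → ℝ) →ₗ[ℝ] (Fin m → ℝ)) {t : ℝ}
    (h : ∀ x, f x = 0 → x ⬝ᵥ M.mulVec x ≤ t * (x ⬝ᵥ x)) {j : ℕ} (hj : m + 1 ≤ j) (hjN : j ≤ N) :
    eigenvalue M j ≤ t := by
  obtain ⟨e, h1, h2⟩ := exists_eigenvalue_coordinates hM
  -- The span of the top j eigenvectors; as j > m, it meets the kernel of `f` nontrivially.
  let ext : (Fin j → ℝ) →ₗ[ℝ] (Fin N → ℝ) :=
    { toFun := fun y i => if h : (i : ℕ) < j then y ⟨i, h⟩ else 0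
      map_add' := by intro x y; ext i; simp only [Pi.add_apply]; split_ifs <;> simp
      map_smul' := by intro r y; ext i; simp }
  obtain ⟨y, hy, hy0⟩ := Submodule.exists_mem_ne_zero_of_ne_bot
    (LinearMap.ker_ne_bot_of_finrank_lt (f := f ∘ₗ e.symm.toLinearMap ∘ₗ ext)
      (by simp only [Module.finrank_fintype_fun_eq_card, Fintype.card_fin]; omega))
  have h3 := h (e.symm (ext y)) hy
  rw [h1, h2, Finset.mul_sum] at h3
  simp only [LinearEquiv.apply_symm_apply] at h3
  have hpos : 0 < ∑ i, ext y i ^ 2 := by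
    obtain ⟨i, hi⟩ := Function.ne_iff.1 hy0
    refine Finset.sum_pos' (fun _ _ => sq_nonneg _)
      ⟨⟨i, by omega⟩, Finset.mem_univ _, ?_⟩
    have : ext y ⟨i, by omega⟩ = y i := by simp [ext]
    rw [this]
    exact sq_pos_iff.2 hi
  have h4 : eigenvalue M j * ∑ i, ext y i ^ 2 ≤ t * ∑ i, ext y i ^ 2 := by
    rw [Finset.mul_sum, Finset.mul_sum]
    refine le_trans (Finset.sum_le_sum fun i _ => ?_) h3
    by_cases hi : (i : ℕ) < j
    · exact mul_le_mul_of_nonneg_right (eigenvalue_anti hM (by omega) (by omega) hjN)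
        (sq_nonneg _)
    · have : ext y i = 0 := by simp [ext, hi]
      simp [this]
  exact le_of_mul_le_mul_right h4 hpos

/-- Courant-Fischer lower bound: a bound for the quadratic form on a subspace of dimension `m`
bounds the `m` largest eigenvalues. -/
lemma le_eigenvalue_of_injective (hM : M.IsHermitian) {m : ℕ} (hmN : m ≤ N)
    (f : (Fin m → ℝ) →ₗ[ℝ] (Fin N → ℝ)) (hf : Function.Injective f) {t : ℝ}
    (h : ∀ y, t * (f y ⬝ᵥ f y) ≤ f y ⬝ᵥ M.mulVec (f y)) {j : ℕ} (hj : 1 ≤ j) (hjm : j ≤ m) :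
    t ≤ eigenvalue M j := by
  obtain ⟨e, h1, h2⟩ := exists_eigenvalue_coordinates hM
  -- Vanishing of the first j - 1 coordinates imposes fewer than m conditions, so some nonzero
  -- vector of the range of `f` meets them all.
  let res : (Fin N → ℝ) →ₗ[ℝ] (Fin (j - 1) → ℝ) :=
    LinearMap.funLeft ℝ ℝ fun i => ⟨i, by omega⟩
  obtain ⟨y, hy, hy0⟩ := Submodule.exists_mem_ne_zero_of_ne_bot
    (LinearMap.ker_ne_bot_of_finrank_lt (f := res ∘ₗ e.toLinearMap ∘ₗ f)
      (by simp only [Module.finrank_fintype_fun_eq_card, Fintype.card_fin]; omega))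
  have h3 := h y
  have hx0 : e (f y) ≠ 0 := by
    intro h0
    exact hy0 (hf (e.injective (by simpa using h0)))
  have hzero : ∀ i : Fin N, (i : ℕ) < j - 1 → e (f y) i = 0 :=
    fun i hi => congrFun (LinearMap.mem_ker.1 hy) ⟨i, hi⟩
  rw [h1, h2, Finset.mul_sum] at h3
  have hpos : 0 < ∑ i, e (f y) i ^ 2 := by
    obtain ⟨i, hi⟩ := Function.ne_iff.1 hx0
    exact Finset.sum_pos' (fun _ _ => sq_nonneg _) ⟨i, Finset.mem_univ _, sq_pos_iff.2 hi⟩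
  have h4 : t * ∑ i, e (f y) i ^ 2 ≤ eigenvalue M j * ∑ i, e (f y) i ^ 2 := by
    rw [Finset.mul_sum, Finset.mul_sum]
    refine le_trans h3 (Finset.sum_le_sum fun i _ => ?_)
    by_cases hi : (i : ℕ) < j - 1
    · simp [hzero i hi]
    · exact mul_le_mul_of_nonneg_right (eigenvalue_anti hM hj (by omega) (by omega))
        (sq_nonneg _)
  exact le_of_mul_le_mul_right h4 hpos

lemma trace_pow_eq_sum_eigenvalue (hM : M.IsHermitian) (r : ℕ) :
    (M ^ r).trace = ∑ i : Fin N, eigenvalue M (i + 1) ^ r := by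
  have h1 : (M ^ r).trace = ∑ i, hM.eigenvalues i ^ r := by
    conv_lhs => rw [hM.spectral_theorem, ← map_pow, Unitary.conjStarAlgAut_apply,
      Matrix.trace_mul_comm, ← mul_assoc, Matrix.diagonal_pow]
    simp [Matrix.trace_diagonal]
  rw [h1]
  unfold Matrix.IsHermitian.eigenvalues
  rw [Equiv.sum_comp _ fun i => hM.eigenvalues₀ i ^ r,
    ← Equiv.sum_comp (finCongr (Fintype.card_fin N).symm)]
  exact Finset.sum_congr rfl fun i _ => by rw [eigenvalue_succ hM]

lemma eigenvalue_pow_le_trace (hM : M.IsHermitian) (k : ℕ) (i : Fin N) :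
    eigenvalue M (i + 1) ^ (2 * k) ≤ (M ^ (2 * k)).trace := by
  rw [trace_pow_eq_sum_eigenvalue hM]
  exact Finset.single_le_sum (f := fun i : Fin N => eigenvalue M (i + 1) ^ (2 * k))
    (fun i _ => (even_two_mul k).pow_nonneg _) (Finset.mem_univ i)

end Eigenvalues

/-! ### The signal: quadratic form of the mean and eigenvalue separation -/

section Separation

variable {N K : ℕ}

lemma edgeProb_comm (g : Fin N → Fin K) (p_s p_d : ℝ) (i j : Fin N) :
    edgeProb g p_s p_d i j = edgeProb g p_s p_d j i := by
  simp only [edgeProb, eq_comm]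

/-- The edge probability is p_d plus (p_s - p_d) times the indicator of a common community, so the
form depends only on the community sums of `x`. -/
lemma sum_edgeProb_mul (g : Fin N → Fin K) (p_s p_d : ℝ) (x : Fin N → ℝ) :
    ∑ i, ∑ j, edgeProb g p_s p_d i j * (x i * x j) =
      (p_s - p_d) * ∑ a, (∑ i, if g i = a then x i else 0) ^ 2 + p_d * (∑ i, x i) ^ 2 := by
  have h1 : ∀ i j, edgeProb g p_s p_d i j * (x i * x j) =
      (p_s - p_d) * ∑ a, ((if g i = a then x i else 0) * (if g j = a then x j else 0)) +
        p_d * (x i * x j) := by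
    intro i j
    rw [Finset.sum_eq_single (g i) (by intro b _ hb; simp [hb.symm]) (by simp)]
    by_cases h : g i = g j
    · simp [edgeProb, h]; ring
    · simp [edgeProb, h, Ne.symm h]
  simp only [h1, Finset.sum_add_distrib, ← Finset.mul_sum]
  congr 2
  · rw [Finset.sum_congr rfl fun i _ => Finset.sum_comm, Finset.sum_comm]
    refine Finset.sum_congr rfl fun a _ => ?_
    rw [sq, Finset.sum_mul_sum]
  · rw [sq, Finset.sum_mul_sum]
    simp only [Finset.mul_sum]

/-- The matrix of expectations of the rescaled stochastic block model. -/
noncomputable def expectedMatrix (g : Fin N → Fin K) (p_s p_d : ℝ) : Matrix (Fin N) (Fin N) ℝ :=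
  Matrix.of fun i j => if i = j then 0 else edgeProb g p_s p_d i j / scale N K p_s p_d

lemma dotProduct_expectedMatrix_mulVec (g : Fin N → Fin K) (p_s p_d : ℝ) (x : Fin N → ℝ) :
    x ⬝ᵥ (expectedMatrix g p_s p_d).mulVec x =
      ((p_s - p_d) * ∑ a, (∑ i, if g i = a then x i else 0) ^ 2 + p_d * (∑ i, x i) ^ 2 -
        p_s * (x ⬝ᵥ x)) / scale N K p_s p_d := by
  rw [← sum_edgeProb_mul]
  simp only [dotProduct, Matrix.mulVec, expectedMatrix, Matrix.of_apply, Finset.mul_sum]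
  rw [← Finset.sum_sub_distrib, Finset.sum_div]
  refine Finset.sum_congr rfl fun i _ => ?_
  rw [← Finset.add_sum_erase _ _ (Finset.mem_univ i),
    ← Finset.add_sum_erase (a := i) (f := fun j => edgeProb g p_s p_d i j * (x i * x j)) _
      (Finset.mem_univ i)]
  have h : edgeProb g p_s p_d i i = p_s := by simp [edgeProb]
  rw [h, if_pos rfl, zero_mul, mul_zero, zero_add, add_sub_cancel_left, Finset.sum_div]
  refine Finset.sum_congr rfl fun j hj => ?_
  rw [if_neg (Finset.ne_of_mem_erase hj).symm]
  ring

lemma card_community (hK : 1 ≤ K) {g : Fin N → Fin K} (hg : IsBalanced g) (a : Fin K) :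
    ((Finset.univ.filter fun i => g i = a).card : ℝ) = (N : ℝ) / K := by
  have h : (K : ℝ) * (Finset.univ.filter fun i => g i = a).card = N := by exact_mod_cast hg a
  have hK0 : (K : ℝ) ≠ 0 := by positivity
  field_simp
  linarith

lemma sum_comp_community (hK : 1 ≤ K) {g : Fin N → Fin K} (hg : IsBalanced g) (f : Fin K → ℝ) :
    ∑ i, f (g i) = (N : ℝ) / K * ∑ a, f a := by
  rw [← Finset.sum_fiberwise Finset.univ g, Finset.mul_sum]
  refine Finset.sum_congr rfl fun a _ => ?_
  rw [Finset.sum_congr rfl (g := fun _ => f a) fun i hi => by rw [(Finset.mem_filter.1 hi).2],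
    Finset.sum_const, nsmul_eq_mul, card_community hK hg]

/-- All but the `K` largest eigenvalues are at most the largest eigenvalue of the noise. -/
lemma eigenvalue_le_noise {g : Fin N → Fin K} {p_s p_d : ℝ} (hp_s : 0 ≤ p_s)
    {A B : Matrix (Fin N) (Fin N) ℝ} (hA : A.IsHermitian) (hB : B.IsHermitian)
    (hAB : A = B + expectedMatrix g p_s p_d) {j : ℕ} (hj : K + 1 ≤ j) (hjN : j ≤ N) :
    eigenvalue A j ≤ eigenvalue B 1 := by
  let f : (Fin N → ℝ) →ₗ[ℝ] (Fin K → ℝ) :=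
    { toFun := fun x a => ∑ i, if g i = a then x i else 0
      map_add' := by
        intro x y; ext a
        simp only [Pi.add_apply, ← Finset.sum_add_distrib]
        exact Finset.sum_congr rfl fun i _ => by split_ifs <;> simp
      map_smul' := by
        intro r x; ext a
        simp [Finset.mul_sum] }
  refine eigenvalue_le_of_ker hA f (fun x hx => ?_) hj hjN
  have hx' : ∀ a, (∑ i, if g i = a then x i else 0) = 0 := fun a => congrFun hx a
  have hsum : ∑ i, x i = 0 := by
    rw [← Finset.sum_fiberwise Finset.univ g]
    exact Finset.sum_eq_zero fun a _ => by rw [Finset.sum_filter]; exact hx' a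
  rw [hAB, Matrix.add_mulVec, dotProduct_add, dotProduct_expectedMatrix_mulVec, hsum]
  simp only [hx']
  have h1 := dotProduct_mulVec_le_eigenvalue_one hB x
  have h2 : 0 ≤ x ⬝ᵥ x := Finset.sum_nonneg fun i _ => mul_self_nonneg _
  have h3 : 0 ≤ p_s * (x ⬝ᵥ x) / scale N K p_s p_d :=
    div_nonneg (mul_nonneg hp_s h2) (Real.sqrt_nonneg _)
  simp only [ne_eq, OfNat.ofNat_ne_zero, not_false_eq_true, zero_pow, Finset.sum_const_zero,
    mul_zero, add_zero, zero_sub, neg_div]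
  linarith

/-- The `K` largest eigenvalues are at least the signal minus the noise. -/
lemma signal_sub_noise_le_eigenvalue (hK : 1 ≤ K) (hKN : K ≤ N) {g : Fin N → Fin K}
    (hg : IsBalanced g) {p_s p_d θ t u : ℝ} (hp_d : 0 ≤ p_d) (hσ : 0 < scale N K p_s p_d)
    (hsep : 2 ≤ K → θ * scale N K p_s p_d ≤ (N : ℝ) / K * (p_s - p_d))
    (hone : K = 1 → θ * scale N K p_s p_d ≤ (N : ℝ) * p_s)
    (hu : p_s / scale N K p_s p_d ≤ u)
    {A B : Matrix (Fin N) (Fin N) ℝ} (hA : A.IsHermitian) (hB : B.IsHermitian)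
    (hAB : A = B + expectedMatrix g p_s p_d)
    (ht : ∀ i : Fin N, -t ≤ eigenvalue B (i + 1)) {j : ℕ} (hj : 1 ≤ j) (hjK : j ≤ K) :
    θ - u - t ≤ eigenvalue A j := by
  set σ := scale N K p_s p_d with hσdef
  have hK0 : (0 : ℝ) < K := by exact_mod_cast hK
  have hN0 : (0 : ℝ) < N := by exact_mod_cast lt_of_lt_of_le hK hKN
  have hinj : Function.Injective (LinearMap.funLeft ℝ ℝ g) := by
    refine LinearMap.funLeft_injective_of_surjective ℝ ℝ g fun a => ?_
    have h1 := hg a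
    have h2 : (Finset.univ.filter fun i => g i = a).card ≠ 0 := by
      intro h0; rw [h0] at h1; omega
    obtain ⟨i, hi⟩ := Finset.card_ne_zero.1 h2
    exact ⟨i, (Finset.mem_filter.1 hi).2⟩
  refine le_eigenvalue_of_injective hA hKN (LinearMap.funLeft ℝ ℝ g) hinj (fun y => ?_) hj hjK
  set n : ℝ := (N : ℝ) / K with hn
  have hn0 : 0 < n := by positivity
  set x : Fin N → ℝ := LinearMap.funLeft ℝ ℝ g y with hx
  have hxi : ∀ i, x i = y (g i) := fun i => rfl
  have hxx : x ⬝ᵥ x = n * ∑ a, y a ^ 2 := by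
    rw [← sum_comp_community hK hg fun a => y a ^ 2]
    simp only [dotProduct, hxi, sq]
  have hS : ∀ a, (∑ i, if g i = a then x i else 0) = n * y a := by
    intro a
    rw [hn, ← card_community hK hg a, ← nsmul_eq_mul, ← Finset.sum_const, Finset.sum_filter]
    refine Finset.sum_congr rfl fun i _ => ?_
    split_ifs with h
    · rw [hxi, h]
    · rfl
  have hT : ∑ i, x i = n * ∑ a, y a := by
    rw [← sum_comp_community hK hg fun a => y a]
    rfl
  have hxx0 : 0 ≤ x ⬝ᵥ x := Finset.sum_nonneg fun i _ => mul_self_nonneg _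
  have hsig : θ * σ * (x ⬝ᵥ x) ≤ (p_s - p_d) * ∑ a, (∑ i, if g i = a then x i else 0) ^ 2 +
      p_d * (∑ i, x i) ^ 2 := by
    simp only [hS, hT, mul_pow, ← Finset.mul_sum]
    rcases Nat.lt_or_ge K 2 with h | h
    · have hK1 : K = 1 := by omega
      have h1 := hone hK1
      have hnN : n = N := by rw [hn, hK1]; simp
      rw [hxx]
      subst hK1
      simp only [Fin.sum_univ_one, Fin.isValue]
      rw [← hnN] at h1
      have := mul_le_mul_of_nonneg_right h1 (mul_nonneg hn0.le (sq_nonneg (y 0)))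
      nlinarith
    · have h1 := mul_le_mul_of_nonneg_right (hsep h) hxx0
      have h2 : 0 ≤ p_d * (n ^ 2 * (∑ a, y a) ^ 2) := by positivity
      rw [hxx] at h1 ⊢
      nlinarith
  rw [hAB, Matrix.add_mulVec, dotProduct_add, dotProduct_expectedMatrix_mulVec, ← hσdef]
  have hB' := le_dotProduct_mulVec_of_le_eigenvalue hB ht x
  have h1 : θ * (x ⬝ᵥ x) - p_s / σ * (x ⬝ᵥ x) ≤
      ((p_s - p_d) * ∑ a, (∑ i, if g i = a then x i else 0) ^ 2 + p_d * (∑ i, x i) ^ 2 -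
        p_s * (x ⬝ᵥ x)) / σ := by
    rw [le_div_iff₀ hσ, sub_mul, div_mul_eq_mul_div, div_mul_cancel₀ _ hσ.ne']
    linarith
  have h2 := mul_le_mul_of_nonneg_right hu hxx0
  linarith

end Separation

/-! ### Choice of the moment exponent -/

section Asymptotics

/-- The first bound asks that (β/α)^(2k) be at least N^(D+1), so k of order log N suffices; its
square is still below any power of N. -/
lemma exists_exponent {φ D M α β : ℝ} (hφ : 0 < φ) (hD : 0 < D) (hM : 0 < M) (hα : 0 < α)
    (hαβ : α < β) :
    ∀ᶠ N : ℕ in Filter.atTop, ∃ k : ℕ,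
      (N : ℝ) * α ^ (2 * k) ≤ (N : ℝ) ^ (-D) * β ^ (2 * k) ∧
      M * ((2 * k + 1 : ℕ) : ℝ) ^ 2 ≤ (N : ℝ) ^ φ := by
  have hρ : 0 < Real.log (β / α) := Real.log_pos ((one_lt_div hα).2 hαβ)
  set C : ℝ := (D + 1) / (2 * Real.log (β / α)) with hC
  have hC0 : 0 < C := by positivity
  -- The 3 absorbs the rounding: 2⌈y⌉ + 1 < 2y + 3 with y = C log N.
  have h1 : (fun x : ℝ => 2 * C * Real.log x + 3) =o[Filter.atTop] fun x : ℝ => x ^ (φ / 2) :=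
    ((isLittleO_log_rpow_atTop (by positivity : 0 < φ / 2)).const_mul_left _).add
      (Asymptotics.isLittleO_const_left.2 (Or.inr
        (tendsto_norm_atTop_atTop.comp (tendsto_rpow_atTop (by positivity)))))
  have h2 := tendsto_natCast_atTop_atTop.eventually
    (h1.bound (by positivity : 0 < Real.sqrt (1 / M)))
  filter_upwards [h2, Filter.eventually_ge_atTop 1] with N hN hN1
  have hN1' : (1 : ℝ) ≤ N := by exact_mod_cast hN1
  have hN0 : (0 : ℝ) < N := by linarith
  have hlog : 0 ≤ Real.log N := Real.log_nonneg hN1'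
  have hβ : 0 < β := hα.trans hαβ
  refine ⟨⌈C * Real.log N⌉₊, ?_, ?_⟩
  · set k := ⌈C * Real.log N⌉₊ with hk
    have hk1 : C * Real.log N ≤ k := Nat.le_ceil _
    have h3 : (N : ℝ) ^ (D + 1) ≤ (β / α) ^ (2 * k) := by
      rw [← Real.rpow_natCast, Real.rpow_def_of_pos hN0, Real.rpow_def_of_pos (by positivity)]
      refine Real.exp_le_exp.2 ?_
      have : (D + 1) * Real.log N = 2 * Real.log (β / α) * (C * Real.log N) := by
        rw [hC]; field_simp
      push_cast
      nlinarith
    rw [div_pow, le_div_iff₀ (by positivity)] at h3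
    have h4 : (N : ℝ) = (N : ℝ) ^ (-D) * (N : ℝ) ^ (D + 1) := by
      rw [← Real.rpow_add hN0]; simp
    calc (N : ℝ) * α ^ (2 * k) = (N : ℝ) ^ (-D) * ((N : ℝ) ^ (D + 1) * α ^ (2 * k)) := by
          rw [← mul_assoc, ← h4]
      _ ≤ _ := by gcongr
  · have hk2 := Nat.ceil_lt_add_one (mul_nonneg hC0.le hlog)
    rw [Real.norm_of_nonneg (by positivity), Real.norm_of_nonneg (by positivity)] at hN
    have h3 : ((2 * ⌈C * Real.log N⌉₊ + 1 : ℕ) : ℝ) ≤ Real.sqrt (1 / M) * (N : ℝ) ^ (φ / 2) := by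
      refine le_trans ?_ hN
      push_cast
      linarith
    calc _ ≤ M * (Real.sqrt (1 / M) * (N : ℝ) ^ (φ / 2)) ^ 2 := by gcongr
      _ = (N : ℝ) ^ φ := by
        rw [mul_pow, Real.sq_sqrt (by positivity), ← Real.rpow_natCast, ← Real.rpow_mul hN0.le]
        field_simp
        norm_num

end Asymptotics

/-! ### The centered matrix and concentration of its spectrum -/

section Noise

variable {Ω : Type*} [MeasurableSpace Ω] {P : Measure Ω} {N K : ℕ}
  {g : Fin N → Fin K} {p_s p_d : ℝ} {A : Ω → Matrix (Fin N) (Fin N) ℝ}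

lemma edgeProb_mem_Icc (hs : p_s ∈ Set.Icc (0 : ℝ) 1) (hd : p_d ∈ Set.Icc (0 : ℝ) 1)
    (i j : Fin N) : edgeProb g p_s p_d i j ∈ Set.Icc (0 : ℝ) 1 := by
  unfold edgeProb
  split_ifs <;> assumption

lemma IsRescaledSBM.integral_ite (hA : IsRescaledSBM P g p_s p_d A)
    (hs : p_s ∈ Set.Icc (0 : ℝ) 1) (hd : p_d ∈ Set.Icc (0 : ℝ) 1) {i j : Fin N} (hij : i ≠ j)
    (x : ℝ) :
    ∫ ω, (if A ω i j = 1 / scale N K p_s p_d then x else 0) ∂P = edgeProb g p_s p_d i j * x := by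
  have hp := edgeProb_mem_Icc (g := g) hs hd i j
  have hm1 : MeasurableSet {ω | A ω i j = 1 / scale N K p_s p_d} :=
    hA.measurable i j (measurableSet_singleton _)
  have h1 : (fun ω => if A ω i j = 1 / scale N K p_s p_d then x else 0) =
      Set.indicator {ω | A ω i j = 1 / scale N K p_s p_d} fun _ => x := by
    ext ω; simp [Set.indicator_apply]
  rw [h1, integral_indicator_const _ hm1, measureReal_def, hA.edge i j hij,
    ENNReal.toReal_ofReal hp.1, smul_eq_mul]

variable [IsProbabilityMeasure P]

lemma IsRescaledSBM.ae_entry (hA : IsRescaledSBM P g p_s p_d A) (hσ : 0 < scale N K p_s p_d)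
    (hs : p_s ∈ Set.Icc (0 : ℝ) 1) (hd : p_d ∈ Set.Icc (0 : ℝ) 1) {i j : Fin N} (hij : i ≠ j) :
    ∀ᵐ ω ∂P, A ω i j = if A ω i j = 1 / scale N K p_s p_d then 1 / scale N K p_s p_d else 0 := by
  have hσ' : 1 / scale N K p_s p_d ≠ 0 := by positivity
  have hp := edgeProb_mem_Icc (g := g) hs hd i j
  have hm1 : MeasurableSet {ω | A ω i j = 1 / scale N K p_s p_d} :=
    hA.measurable i j (measurableSet_singleton _)
  have hm0 : MeasurableSet {ω | A ω i j = 0} := hA.measurable i j (measurableSet_singleton _)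
  have h1 : P ({ω | A ω i j = 1 / scale N K p_s p_d} ∪ {ω | A ω i j = 0}) = 1 := by
    rw [measure_union _ hm0, hA.edge i j hij, hA.nonedge i j hij,
      ← ENNReal.ofReal_add hp.1 (by linarith [hp.2])]
    · simp
    · rw [Set.disjoint_left]
      intro ω h1 h0
      exact hσ' (h1.symm.trans h0)
  have h2 := (mem_ae_iff_prob_eq_one (hm1.union hm0)).2 h1
  filter_upwards [h2] with ω hω
  rcases hω with h | h
  · rw [Set.mem_ofPred_eq] at h
    rw [if_pos h, h]
  · rw [Set.mem_ofPred_eq] at h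
    rw [if_neg (fun h' => hσ' (h'.symm.trans h)), h]

lemma IsRescaledSBM.mean_eq (hA : IsRescaledSBM P g p_s p_d A) (hσ : 0 < scale N K p_s p_d)
    (hs : p_s ∈ Set.Icc (0 : ℝ) 1) (hd : p_d ∈ Set.Icc (0 : ℝ) 1) :
    mean P A = expectedMatrix g p_s p_d := by
  ext i j
  simp only [mean, expectedMatrix, Matrix.of_apply]
  split_ifs with hij
  · subst hij
    have hm : MeasurableSet {ω | A ω i i = 0} := hA.measurable i i (measurableSet_singleton _)
    have h0 : (fun ω => A ω i i) =ᵐ[P] fun _ => 0 :=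
      (mem_ae_iff_prob_eq_one hm).2 (hA.diag i)
    rw [integral_congr_ae h0, integral_zero]
  · rw [integral_congr_ae (hA.ae_entry hσ hs hd hij), hA.integral_ite hs hd hij]
    ring

/-- This is what σ is designed for. The index w = v is included, so actual rows, with zero diagonal,
have variance at most one after scaling. -/
lemma sum_edgeProb_variance (hK : 1 ≤ K) (hg : IsBalanced g) (hσ : 0 < scale N K p_s p_d)
    (v : Fin N) :
    ∑ w, edgeProb g p_s p_d v w * (1 - edgeProb g p_s p_d v w) = scale N K p_s p_d ^ 2 := by
  have hK0 : (K : ℝ) ≠ 0 := by positivity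
  set f : Fin K → ℝ := fun a => (if a = g v then p_s * (1 - p_s) - p_d * (1 - p_d) else 0) +
    p_d * (1 - p_d) with hf
  have h1 : ∀ w, edgeProb g p_s p_d v w * (1 - edgeProb g p_s p_d v w) = f (g w) := by
    intro w
    rw [hf]
    by_cases h : g v = g w
    · simp [edgeProb, h]
    · simp [edgeProb, h, Ne.symm h]
  rw [Finset.sum_congr rfl fun w _ => h1 w, sum_comp_community hK hg, hf,
    scale, Real.sq_sqrt (Real.sqrt_pos.1 hσ).le, Finset.sum_add_distrib]
  simp only [Finset.sum_ite_eq', Finset.mem_univ, if_true, Finset.sum_const, Finset.card_univ,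
    Fintype.card_fin, nsmul_eq_mul]
  field_simp
  ring

/-- The centered matrix is almost surely a hollow symmetric matrix with independent, centered and
bounded entries above the diagonal, whose rows have variance at most one. -/
lemma IsRescaledSBM.exists_noise (hA : IsRescaledSBM P g p_s p_d A) (hK : 1 ≤ K)
    (hg : IsBalanced g) (hσ : 0 < scale N K p_s p_d)
    (hs : p_s ∈ Set.Icc (0 : ℝ) 1) (hd : p_d ∈ Set.Icc (0 : ℝ) 1) :
    ∃ Z : Sym2 (Fin N) → Ω → ℝ, (∀ e, Measurable (Z e)) ∧
      (∀ e ω, |Z e ω| ≤ 1 / scale N K p_s p_d) ∧ (∀ e, ∫ ω, Z e ω ∂P = 0) ∧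
      iIndepFun (fun (e : {e : Fin N × Fin N // e.1 < e.2}) => Z s(e.1.1, e.1.2)) P ∧
      (∀ v, ∑ w ∈ Finset.univ.erase v, ∫ ω, Z s(v, w) ω ^ 2 ∂P ≤ 1) ∧
      ∀ᵐ ω ∂P, A ω = hollowMatrix (fun e => Z e ω) + expectedMatrix g p_s p_d := by
  set σ := scale N K p_s p_d with hσdef
  set q := edgeProb g p_s p_d with hq
  have hσ1 : 0 < 1 / σ := by positivity
  -- Entries take only the values 0 and 1/σ almost surely. Rounding every other value to 0 makes the
  -- bound 1/σ hold everywhere, and applying `T` entrywise preserves independence.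
  let T : Fin N → Fin N → ℝ → ℝ := fun i j x =>
    if i = j then 0 else (if x = 1 / σ then 1 / σ else 0) - q i j / σ
  have hTm : ∀ i j, Measurable (T i j) := by
    intro i j
    by_cases h : i = j
    · simp only [T, if_pos h]; exact measurable_const
    · simp only [T, if_neg h]
      exact (Measurable.ite (measurableSet_singleton _) measurable_const
        measurable_const).sub_const _
  have hTb : ∀ i j x, |T i j x| ≤ 1 / σ := by
    intro i j x
    have hp := edgeProb_mem_Icc (g := g) hs hd i j
    have h1 : 0 ≤ q i j / σ := div_nonneg hp.1 hσ.le
    have h2 : q i j / σ ≤ 1 / σ := div_le_div_of_nonneg_right hp.2 hσ.le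
    simp only [T]
    rw [abs_le]
    split_ifs <;> constructor <;> linarith
  let Z : Sym2 (Fin N) → Ω → ℝ := fun e ω => Sym2.lift ⟨fun i j => T i j (A ω i j), by
    intro i j
    simp only [T, hq, edgeProb_comm g p_s p_d i j, eq_comm (a := i), (hA.symm ω).apply i j]⟩ e
  have hZ : ∀ i j, Z s(i, j) = fun ω => T i j (A ω i j) := fun i j => rfl
  have hB : ∀ (i j : Fin N) (x : ℝ),
      BoundedMeasurable fun ω => if A ω i j = 1 / σ then x else 0 := by
    intro i j x
    refine ⟨Measurable.ite (hA.measurable i j (measurableSet_singleton _)) measurable_const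
      measurable_const, |x|, fun ω => ?_⟩
    dsimp only
    split_ifs <;> simp
  refine ⟨Z, fun e => ?_, fun e ω => ?_, fun e => ?_, ?_, fun v => ?_, ?_⟩
  · induction e using Sym2.ind with
    | _ i j => exact (hTm i j).comp (hA.measurable i j)
  · induction e using Sym2.ind with
    | _ i j => exact hTb i j _
  · induction e using Sym2.ind with
    | _ i j =>
      rw [hZ]
      by_cases hij : i = j
      · simp [T, hij]
      · simp only [T, if_neg hij]
        rw [integral_sub (hB i j _).integrable (integrable_const _),
          hA.integral_ite hs hd hij]
        simp only [integral_const, probReal_univ, smul_eq_mul, ← hq]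
        ring
  · exact hA.indep.comp (fun e => T e.1.1 e.1.2) fun e => hTm _ _
  · have hvar : ∀ w ∈ Finset.univ.erase v,
        ∫ ω, Z s(v, w) ω ^ 2 ∂P = q v w * (1 - q v w) / σ ^ 2 := by
      intro w hw
      have hvw : v ≠ w := (Finset.ne_of_mem_erase hw).symm
      have h1 : ∀ ω, Z s(v, w) ω ^ 2 =
          (if A ω v w = 1 / σ then (1 - 2 * q v w) / σ ^ 2 else 0) + q v w ^ 2 / σ ^ 2 := by
        intro ω
        rw [hZ]
        simp only [T, if_neg hvw]
        split_ifs <;> ring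
      simp only [h1]
      rw [integral_add (hB v w _).integrable (integrable_const _), hA.integral_ite hs hd hvw]
      simp only [integral_const, probReal_univ, smul_eq_mul, ← hq]
      ring
    rw [Finset.sum_congr rfl hvar, ← Finset.sum_div, div_le_one (by positivity), hσdef,
      ← sum_edgeProb_variance hK hg hσ v]
    refine Finset.sum_le_sum_of_subset_of_nonneg (Finset.subset_univ _) fun w _ _ => ?_
    have hp := edgeProb_mem_Icc (g := g) hs hd v w
    exact mul_nonneg hp.1 (by linarith [hp.2])
  · have h1 : ∀ᵐ ω ∂P, ∀ i j, i ≠ j → A ω i j = if A ω i j = 1 / σ then 1 / σ else 0 := by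
      simp only [ae_all_iff]
      exact fun i j hij => hA.ae_entry hσ hs hd hij
    have h2 : ∀ᵐ ω ∂P, ∀ i, A ω i i = 0 := by
      rw [ae_all_iff]
      exact fun i => (mem_ae_iff_prob_eq_one
        (hA.measurable i i (measurableSet_singleton 0))).2 (hA.diag i)
    filter_upwards [h1, h2] with ω h1 h2
    ext i j
    simp only [Matrix.add_apply, hollowMatrix, expectedMatrix, Matrix.of_apply]
    by_cases hij : i = j
    · simp [hij, h2]
    · rw [if_neg hij, if_neg hij, hZ]
      simp only [T, if_neg hij]
      rw [← h1 i j hij]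
      ring

/-- Concentration of the spectrum of the noise, by Markov's inequality for a high trace moment. -/
lemma measure_exists_eigenvalue_gt_le {Z : Sym2 (Fin N) → Ω → ℝ} {a β : ℝ} (ha0 : 0 ≤ a)
    (hβ : 0 < β) (hm : ∀ e, Measurable (Z e)) (ha : ∀ e ω, |Z e ω| ≤ a)
    (h0 : ∀ e, ∫ ω, Z e ω ∂P = 0)
    (hind : iIndepFun (fun (e : {e : Fin N × Fin N // e.1 < e.2}) => Z s(e.1.1, e.1.2)) P)
    (hrow : ∀ v, ∑ w ∈ Finset.univ.erase v, ∫ ω, Z s(v, w) ω ^ 2 ∂P ≤ 1) (k : ℕ) {ε : ℝ}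
    (hk : N * (2 + ((2 * k + 1 : ℕ) : ℝ) ^ 3 * a ^ 2 + ((2 * k + 1 : ℕ) : ℝ) ^ 2 * a) ^ (2 * k) ≤
      ε * β ^ (2 * k)) :
    P {ω | ∃ i : Fin N, β < |eigenvalue (hollowMatrix fun e => Z e ω) (i + 1)|} ≤
      ENNReal.ofReal ε := by
  have hB : ∀ e, BoundedMeasurable (Z e) := fun e => ⟨hm e, a, ha e⟩
  have h1 := integral_trace_pow_le ha0 hm ha h0 hind hrow (2 * k)
  rw [Fintype.card_fin] at h1
  have h2 := mul_meas_ge_le_integral_of_nonneg (μ := P)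
    (f := fun ω => (hollowMatrix (fun e => Z e ω) ^ (2 * k)).trace)
    (Filter.Eventually.of_forall fun ω => by
      change 0 ≤ (hollowMatrix (fun e => Z e ω) ^ (2 * k)).trace
      rw [trace_pow_eq_sum_eigenvalue (hollowMatrix_isHermitian _)]
      exact Finset.sum_nonneg fun i _ => (even_two_mul k).pow_nonneg _)
    (boundedMeasurable_trace_hollowMatrix_pow hB (2 * k)).integrable (β ^ (2 * k))
  have h3 : P.real {ω | β ^ (2 * k) ≤ (hollowMatrix (fun e => Z e ω) ^ (2 * k)).trace} ≤ ε := by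
    have hpos : 0 < β ^ (2 * k) := by positivity
    refine le_of_mul_le_mul_left ?_ hpos
    rw [mul_comm _ ε]
    exact h2.trans (h1.trans hk)
  refine (measure_mono ?_).trans ((ENNReal.le_ofReal_iff_toReal_le (measure_ne_top _ _)
    (measureReal_nonneg.trans h3)).2 h3)
  rintro ω ⟨i, hi⟩
  refine le_trans ?_ (eigenvalue_pow_le_trace (hollowMatrix_isHermitian _) k i)
  rw [← (even_two_mul k).pow_abs (eigenvalue _ _)]
  exact pow_le_pow_left₀ hβ.le hi.le _

end Noise

/-! ### Bounds for the scaling σ -/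

section Scale

variable {N K : ℕ} {p_s p_d φ : ℝ}

/-- The within-community term alone suffices: 1 - p_s ≥ 1/2 and N p_s ≥ N^(2φ). -/
lemma rpow_le_scale_sq (hK : 1 ≤ K) (hN : 1 ≤ N) (hs0 : (N : ℝ) ^ (-1 + 2 * φ) ≤ p_s)
    (hs1 : p_s ≤ 1 / 2) (hd : p_d ∈ Set.Icc (0 : ℝ) 1) :
    (N : ℝ) ^ (2 * φ) / (2 * K) ≤ scale N K p_s p_d ^ 2 := by
  have hN0 : (0 : ℝ) < N := by exact_mod_cast hN
  have hK1 : (1 : ℝ) ≤ K := by exact_mod_cast hK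
  have hK0 : (0 : ℝ) < K := by linarith
  have hp : 0 ≤ p_s := (Real.rpow_nonneg hN0.le _).trans hs0
  have h1 : 0 ≤ (N : ℝ) * ((K : ℝ) - 1) / K * (p_d * (1 - p_d)) :=
    mul_nonneg (div_nonneg (mul_nonneg hN0.le (by linarith)) hK0.le)
      (mul_nonneg hd.1 (by linarith [hd.2]))
  have h2 : (N : ℝ) ^ (2 * φ) = N * (N : ℝ) ^ (-1 + 2 * φ) := by
    rw [Real.rpow_add hN0, Real.rpow_neg_one]
    field_simp
  have h3 : 0 ≤ (N : ℝ) / K * (p_s * (1 - p_s)) :=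
    mul_nonneg (by positivity) (mul_nonneg hp (by linarith))
  have h4 : (N : ℝ) ^ (2 * φ) / (2 * K) ≤ (N : ℝ) / K * (p_s * (1 - p_s)) := by
    rw [h2]
    calc _ = (N : ℝ) / K * ((N : ℝ) ^ (-1 + 2 * φ) * (1 / 2)) := by field_simp
      _ ≤ _ := by gcongr; linarith
  rw [scale, Real.sq_sqrt (by linarith)]
  linarith

/-- For a single community this replaces the separation hypothesis: the signal N p_s/σ is at least
σ, which is large. -/
lemma scale_sq_le_of_eq_one (hK : K = 1) (hp : 0 ≤ p_s) :
    scale N K p_s p_d ^ 2 ≤ N * p_s := by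
  subst hK
  have h : scale N 1 p_s p_d = Real.sqrt (N * (p_s * (1 - p_s))) := by simp [scale]
  rw [h]
  have h1 : (0 : ℝ) ≤ N * p_s := by positivity
  have h2 : (N : ℝ) * (p_s * (1 - p_s)) ≤ N * p_s := by
    gcongr
    nlinarith
  rcases le_total 0 ((N : ℝ) * (p_s * (1 - p_s))) with h3 | h3
  · rwa [Real.sq_sqrt h3]
  · rw [Real.sqrt_eq_zero_of_nonpos h3]; simpa using h1

end Scale

end SparseSBM

/-! ### Choice of constants and conclusion -/

theorem theorem2p11
    (φ : ℝ) (hφ : 0 < φ) (K : ℕ) (hK : 1 ≤ K) (δ : ℝ) (hδ : 0 < δ) :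
    ∃ c : ℝ, 0 < c ∧ ∃ γ : ℝ, 0 < γ ∧
      ∀ D : ℝ, 0 < D → ∃ N₀ : ℕ, ∀ N : ℕ, N₀ ≤ N →
        ∀ (g : Fin N → Fin K), SparseSBM.IsBalanced g →
        ∀ (p_s p_d : ℝ),
          (N : ℝ) ^ (-1 + 2 * φ) ≤ p_s → p_s ≤ (N : ℝ) ^ (-2 * φ) →
          (N : ℝ) ^ (-1 + 2 * φ) ≤ p_d → p_d ≤ (N : ℝ) ^ (-2 * φ) →
          (2 ≤ K → (4 + δ) * SparseSBM.scale N K p_s p_d ≤ (N : ℝ) / K * (p_s - p_d)) →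
        ∀ {Ω : Type*} [MeasurableSpace Ω] (P : Measure Ω) [IsProbabilityMeasure P]
          (A : Ω → Matrix (Fin N) (Fin N) ℝ), SparseSBM.IsRescaledSBM P g p_s p_d A →
          P {ω | (∀ j : ℕ, K + 1 ≤ j → j ≤ N →
                    SparseSBM.eigenvalue (A ω) j
                      ≤ SparseSBM.eigenvalue (SparseSBM.centered P A ω) 1) ∧
                 SparseSBM.eigenvalue (SparseSBM.centered P A ω) 1 ≤ 2 + c ∧
                 (∀ i : ℕ, 1 ≤ i → i ≤ K → 2 + c ≤ SparseSBM.eigenvalue (A ω) i) ∧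
                 (∀ i j : ℕ, 1 ≤ i → i ≤ K → K + 1 ≤ j → j ≤ N →
                    γ ≤ SparseSBM.eigenvalue (A ω) i - SparseSBM.eigenvalue (A ω) j)}ᶜ
            ≤ ENNReal.ofReal ((N : ℝ) ^ (-D)) := by
  have hη : 0 < δ / 8 := by positivity
  have hK0 : (0 : ℝ) < K := by exact_mod_cast hK
  -- Target size of L²/σ. The bounds 1/4 and δ/32 keep the moment base within 2 + δ/16 and make
  -- p_s/σ ≤ δ/8; the bound 1/(4 + δ) forces σ ≥ 4 + δ, needed when K = 1.
  set s₀ : ℝ := min (min 1 (δ / 8) / 4) (1 / (4 + δ)) with hs₀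
  have hs₀pos : 0 < s₀ := by positivity
  have hs₀1 : s₀ ≤ 1 / 4 :=
    (min_le_left _ _).trans (div_le_div_of_nonneg_right (min_le_left _ _) (by norm_num))
  have hs₀η : s₀ ≤ δ / 8 / 4 :=
    (min_le_left _ _).trans (div_le_div_of_nonneg_right (min_le_right _ _) (by norm_num))
  have hs₀δ : s₀ ≤ 1 / (4 + δ) := min_le_right _ _
  -- There is room to spare: the noise stays below 2 + δ/8, while the top K eigenvalues are at least
  -- (4 + δ) - δ/8 - (2 + δ/8) = 2 + 3δ/4.
  refine ⟨δ / 4, by positivity, δ / 4, by positivity, fun D hD => ?_⟩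
  have hexp := SparseSBM.exists_exponent (M := Real.sqrt (2 * K) / s₀) hφ hD (by positivity)
    (by positivity : 0 < 2 + δ / 8 / 2) (by linarith : 2 + δ / 8 / 2 < 2 + δ / 8)
  have hhalf : ∀ᶠ N : ℕ in Filter.atTop, (N : ℝ) ^ (-2 * φ) < 1 / 2 := by
    have h := (tendsto_rpow_neg_atTop (by positivity : 0 < 2 * φ)).comp
      tendsto_natCast_atTop_atTop
    simpa [neg_mul] using h.eventually_lt_const (by norm_num : (0 : ℝ) < 1 / 2)
  obtain ⟨N₀, hN₀⟩ := Filter.eventually_atTop.1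
    (hexp.and (hhalf.and (Filter.eventually_ge_atTop K)))
  refine ⟨N₀, fun N hN g hg p_s p_d hs0 hs1 hd0 hd1 hsep Ω _ P _ A hA => ?_⟩
  obtain ⟨⟨k, hk1, hk2⟩, hN2, hKN⟩ := hN₀ N hN
  have hN0 : (0 : ℝ) < N := by exact_mod_cast lt_of_lt_of_le hK hKN
  have hps : p_s ∈ Set.Icc (0 : ℝ) 1 :=
    ⟨(Real.rpow_nonneg hN0.le _).trans hs0, by linarith⟩
  have hpd : p_d ∈ Set.Icc (0 : ℝ) 1 :=
    ⟨(Real.rpow_nonneg hN0.le _).trans hd0, by linarith⟩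
  have hscale := SparseSBM.rpow_le_scale_sq hK (hK.trans hKN) hs0 (by linarith) hpd
  set σ := SparseSBM.scale N K p_s p_d with hσdef
  have hNφ : 0 < (N : ℝ) ^ φ := Real.rpow_pos_of_pos hN0 _
  have hσlow : (N : ℝ) ^ φ ≤ Real.sqrt (2 * K) * σ := by
    refine le_of_sq_le_sq ?_ (mul_nonneg (Real.sqrt_nonneg _) (Real.sqrt_nonneg _))
    rw [mul_pow, Real.sq_sqrt (by positivity), ← Real.rpow_natCast, ← Real.rpow_mul hN0.le,
      mul_comm φ]
    rw [div_le_iff₀ (by positivity)] at hscale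
    push_cast
    linarith
  have hσ : 0 < σ := pos_of_mul_pos_right (hNφ.trans_le hσlow) (Real.sqrt_nonneg _)
  set L : ℝ := ((2 * k + 1 : ℕ) : ℝ) with hL
  have hL1 : 1 ≤ L := by rw [hL]; exact_mod_cast (by omega : 1 ≤ 2 * k + 1)
  have hLσ : L ^ 2 * (1 / σ) ≤ s₀ := by
    rw [mul_one_div, div_le_iff₀ hσ]
    have h1 := hk2.trans hσlow
    rw [div_mul_eq_mul_div, div_le_iff₀ hs₀pos, mul_assoc, mul_comm σ] at h1
    exact le_of_mul_le_mul_left h1 (by positivity)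
  have hσ1 : 0 < 1 / σ := by positivity
  have hσs₀ : 1 / σ ≤ s₀ := le_trans (le_mul_of_one_le_left hσ1.le (one_le_pow₀ hL1)) hLσ
  have hmoment : 2 + L ^ 3 * (1 / σ) ^ 2 + L ^ 2 * (1 / σ) ≤ 2 + δ / 8 / 2 := by
    have h1 : L ^ 3 * (1 / σ) ^ 2 ≤ (L ^ 2 * (1 / σ)) ^ 2 := by
      rw [mul_pow, ← pow_mul]
      exact mul_le_mul_of_nonneg_right (pow_le_pow_right₀ hL1 (by norm_num)) (sq_nonneg _)
    have h2 : 0 ≤ L ^ 2 * (1 / σ) := by positivity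
    nlinarith
  obtain ⟨Z, hZm, hZb, hZ0, hZi, hZr, hZA⟩ := hA.exists_noise hK hg hσ hps hpd
  -- Outside a null set, failure of the conclusion forces a noise eigenvalue beyond 2 + δ/8 in
  -- absolute value. Only monotonicity of the measure is used, so no measurability of eigenvalues is
  -- needed.
  refine le_trans (measure_mono_ae ?_) (SparseSBM.measure_exists_eigenvalue_gt_le hσ1.le
    (by positivity : 0 < 2 + δ / 8) hZm hZb hZ0 hZi hZr k (le_trans ?_ hk1))
  swap
  · gcongr
  filter_upwards [hZA] with ω hω hbad
  by_contra hgood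
  refine hbad ?_
  have hB := SparseSBM.hollowMatrix_isHermitian (fun e => Z e ω)
  have hAherm : (A ω).IsHermitian := by
    rw [Matrix.IsHermitian, Matrix.conjTranspose_eq_transpose_of_trivial]
    exact hA.symm ω
  have hcent : SparseSBM.centered P A ω = SparseSBM.hollowMatrix (fun e => Z e ω) := by
    rw [SparseSBM.centered, hA.mean_eq hσ hps hpd, hω, add_sub_cancel_right]
  set B := SparseSBM.hollowMatrix (fun e => Z e ω) with hBdef
  have hev : ∀ i : Fin N, |SparseSBM.eigenvalue B (i + 1)| ≤ 2 + δ / 8 :=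
    fun i => not_lt.1 fun h => hgood ⟨i, h⟩
  have htop : SparseSBM.eigenvalue B 1 ≤ 2 + δ / 8 :=
    (abs_le.1 (hev ⟨0, lt_of_lt_of_le hK hKN⟩)).2
  have hlow : ∀ i : ℕ, 1 ≤ i → i ≤ K →
      4 + δ - δ / 8 - (2 + δ / 8) ≤ SparseSBM.eigenvalue (A ω) i := by
    intro i hi hiK
    refine SparseSBM.signal_sub_noise_le_eigenvalue hK hKN hg hpd.1 hσ hsep (fun hK1 => ?_) ?_
      hAherm hB hω (fun i => (abs_le.1 (hev i)).1) hi hiK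
    · have h1 : 4 + δ ≤ σ := by
        have := hσs₀.trans hs₀δ
        rwa [one_div_le_one_div hσ (by positivity)] at this
      calc (4 + δ) * σ ≤ σ ^ 2 := by rw [sq]; gcongr
        _ ≤ N * p_s := SparseSBM.scale_sq_le_of_eq_one hK1 hps.1
    · calc p_s / σ ≤ 1 / σ := div_le_div_of_nonneg_right hps.2 hσ.le
        _ ≤ δ / 8 := by linarith
  have hhigh : ∀ j : ℕ, K + 1 ≤ j → j ≤ N →
      SparseSBM.eigenvalue (A ω) j ≤ SparseSBM.eigenvalue B 1 :=
    fun j hj hjN => SparseSBM.eigenvalue_le_noise hps.1 hAherm hB hω hj hjN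
  rw [Set.mem_ofPred_eq, hcent]
  refine ⟨hhigh, by linarith, fun i hi hiK => ?_, fun i j hi hiK hj hjN => ?_⟩
  · linarith [hlow i hi hiK]
  · linarith [hlow i hi hiK, hhigh j hj hjN]
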